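/- Let $r\ge 1$, $m\ge 1$, $b\ge 2$ be integers. Consider the asynchronous shared-memory model with one writer and $r$ readers, which are deterministic processes with arbitrary local states (kept from one operation to the next), that communicate only through $n$ physical registers. Each physical register holds one of $b$ values, is atomic (each read and each write takes effect instantaneously), and is single-writer: it can be read by every process, but can be written only by one fixed process, its owner, which may be the writer or any reader. The processes implement a single-writer register with $m$ values and some initial value: the writer may repeatedly invoke operations $\mathrm{write}(v)$ for any of the $m$ values $v$, and each reader may repeatedly invoke $\mathrm{read}$ operations. The implementation is regular if in every execution every completed read returns either the value of the last write completed before the read started (the initial value if there is none) or the value of a write concurrent with the read. It is obstruction-free if from every reachable configuration every pending operation terminates after finitely many steps when its process runs in isolation. Then every obstruction-free regular implementation satisfies $$ n \;\ge\; \left\lceil \min\left(\frac{m-1}{b-1},\; r+\frac{\log m}{\log b}\right)\right\rceil , $$ whether or not there are readers that never write to a physical register. -/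

import Mathlib

universe u

namespace SharedRegister

/-- The processes of the system: `none` is the writer of the implemented register,
`some j` is its `j`-th reader. -/
abbrev Proc (r : ℕ) : Type := Option (Fin r)

/-- Operations that a process can invoke on the implemented `m`-valued register:
the writer invokes `write v` for a value `v`, a reader invokes `read`. -/
abbrev Op {r : ℕ} (m : ℕ) : Proc r → Type
  | none => Fin m
  | some _ => Unit

/-- Responses of these operations: a write returns an acknowledgement, a read returns a value. -/
abbrev Res {r : ℕ} (m : ℕ) : Proc r → Type
  | none => Unit
  | some _ => Fin m

/-- What a process with a pending operation does next, as determined by its local state: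
read physical register `i` and continue in a local state that depends on the value read,
write `x` to physical register `i`, or return from the pending operation. -/
inductive Action (n b : ℕ) (S : Type u) (R : Type) : Type u
  | read (i : Fin n) (k : Fin b → S)
  | write (i : Fin n) (x : Fin b) (s : S)
  | ret (y : R) (s : S)

/-- A (deterministic) algorithm for one writer and `r` readers that provides operations of an
`m`-valued register and communicates through `n` physical single-writer registers, each with
`b` values. Local states are arbitrary and persist from one operation of a process to the next.
Every process may read every physical register, but only its owner may write to it. -/
structure Algorithm (r n m b : ℕ) where
  /-- local states of each process -/
  State : Proc r → Type u
  /-- initial local states -/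
  initState : (p : Proc r) → State p
  /-- initial contents of the physical registers -/
  initMem : Fin n → Fin b
  /-- the process that owns a physical register -/
  owner : Fin n → Proc r
  /-- effect of the invocation of an operation on the local state -/
  start : (p : Proc r) → Op m p → State p → State p
  /-- the next action of a process with a pending operation -/
  action : (p : Proc r) → State p → Action n b (State p) (Res m p)
  /-- the physical registers are single-writer -/
  single_writer : ∀ (p : Proc r) (s : State p) (i : Fin n) (x : Fin b) (s' : State p),
    action p s = Action.write i x s' → owner i = p

/-- Events of an execution: invocation of an operation, an access (read or write) to a physical
register, response of an operation. -/
inductive Event (r m : ℕ) : Type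
  | inv (p : Proc r) (o : Op m p)
  | access (p : Proc r)
  | res (p : Proc r) (y : Res m p)

namespace Algorithm

variable {r n m b : ℕ}

/-- A configuration: contents of all physical registers, local states of all processes, and which
processes have a pending operation. -/
structure Config (A : Algorithm.{u} r n m b) where
  mem : Fin n → Fin b
  state : (p : Proc r) → A.State p
  active : Proc r → Bool

/-- The initial configuration. -/
def init (A : Algorithm.{u} r n m b) : A.Config where
  mem := A.initMem
  state := A.initState
  active := fun _ => false

/-- One step of the system. Accesses to physical registers take effect instantaneously, that is,
the physical registers are atomic. -/
inductive Step (A : Algorithm.{u} r n m b) : A.Config → Event r m → A.Config → Prop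
  | inv (C : A.Config) (p : Proc r) (o : Op m p) (idle : C.active p = false) :
      Step A C (Event.inv p o)
        { mem := C.mem
          state := Function.update C.state p (A.start p o (C.state p))
          active := Function.update C.active p true }
  | read (C : A.Config) (p : Proc r) (i : Fin n) (k : Fin b → A.State p)
      (busy : C.active p = true) (h : A.action p (C.state p) = Action.read i k) :
      Step A C (Event.access p)
        { mem := C.mem
          state := Function.update C.state p (k (C.mem i))
          active := C.active }
  | write (C : A.Config) (p : Proc r) (i : Fin n) (x : Fin b) (s : A.State p)
      (busy : C.active p = true) (h : A.action p (C.state p) = Action.write i x s) :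
      Step A C (Event.access p)
        { mem := Function.update C.mem i x
          state := Function.update C.state p s
          active := C.active }
  | res (C : A.Config) (p : Proc r) (y : Res m p) (s : A.State p)
      (busy : C.active p = true) (h : A.action p (C.state p) = Action.ret y s) :
      Step A C (Event.res p y)
        { mem := C.mem
          state := Function.update C.state p s
          active := Function.update C.active p false }

/-- `A.Execution h C`: some finite execution from the initial configuration has the sequence of
events `h` and ends in the configuration `C`. The schedule and the times of the invocations are
arbitrary; a process that crashes takes no more steps. -/
inductive Execution (A : Algorithm.{u} r n m b) : List (Event r m) → A.Config → Prop
  | nil : Execution A [] A.init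
  | snoc {h : List (Event r m)} {C C' : A.Config} {e : Event r m} :
      Execution A h C → A.Step C e C' → Execution A (h ++ [e]) C'

end Algorithm

variable {r m : ℕ}

/-- After the events `h`, the last completed write is a write of `v`, where the initial value `v₀`
counts as written before the execution starts. -/
def LastCompletedWrite (v₀ : Fin m) (h : List (Event r m)) (v : Fin m) : Prop :=
  (Event.res none () ∉ h ∧ v = v₀) ∨
    ∃ h₁ h₂ h₃ : List (Event r m),
      h = h₁ ++ [Event.inv none v] ++ h₂ ++ [Event.res none ()] ++ h₃ ∧
        Event.res none () ∉ h₂ ∧ Event.res none () ∉ h₃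

/-- After the events `h`, a write of `v` is pending. -/
def PendingWrite (h : List (Event r m)) (v : Fin m) : Prop :=
  ∃ h₁ h₂ : List (Event r m), h = h₁ ++ [Event.inv none v] ++ h₂ ∧ Event.res none () ∉ h₂

/-- The sequence of events `h` satisfies the specification of a regular single-writer register
with initial value `v₀`: every completed read returns the value of the last write that was
completed before the read started, or the value of a write concurrent with the read (one that was
pending when the read started, or was invoked between the start and the end of the read). -/
def Regular (v₀ : Fin m) (h : List (Event r m)) : Prop :=
  ∀ (j : Fin r) (v : Fin m) (h₁ h₂ h₃ : List (Event r m)),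
    h = h₁ ++ [Event.inv (some j) ()] ++ h₂ ++ [Event.res (some j) v] ++ h₃ →
    (∀ w : Fin m, Event.res (some j) w ∉ h₂) →
      LastCompletedWrite v₀ h₁ v ∨ PendingWrite h₁ v ∨ Event.inv none v ∈ h₂

namespace Algorithm

variable {n b : ℕ}

/-- The algorithm implements an `m`-valued regular register (with some initial value). -/
def ImplementsRegular (A : Algorithm.{u} r n m b) : Prop :=
  ∃ v₀ : Fin m, ∀ (h : List (Event r m)) (C : A.Config), A.Execution h C → Regular v₀ h

/-- Obstruction-freedom: from every reachable configuration, every pending operation terminates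
after finitely many steps if its process runs in isolation. (A process with a pending operation
has exactly one possible step.) -/
def ObstructionFree (A : Algorithm.{u} r n m b) : Prop :=
  ∀ (h : List (Event r m)) (C : A.Config), A.Execution h C →
    ∀ p : Proc r, C.active p = true →
      ∃ (C₁ C₂ : A.Config) (y : Res m p),
        Relation.ReflTransGen (fun D D' : A.Config => A.Step D (Event.access p) D') C C₁ ∧
          A.Step C₁ (Event.res p y) C₂

end Algorithm

end SharedRegister

/-!
If every reader owns a register, the writer owns at most `n - r` of them. Starting from the initial
configuration, completed writes of different values must leave different contents in these, because
a reader that runs alone afterwards sees nothing else that differs; so `m ≤ b ^ (n - r)`.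

Otherwise some reader `j` never writes, so the writer cannot notice that `j` is reading. Consider
the pairs `(i, x)` such that the writer, writing only values from `V`, can make register `i`
contain `x`. Let `y` be the result of an isolated read by `j` from `C`, and let `W` be `V` without
one value, chosen such that `y ∉ W`. Suppose that the writer, writing only values from `W`, could
restore each single register, over and over again, to its content in `C`. Doing so just before `j`
reads that register, it would make `j` return `y` although only values from `W` are written, which
contradicts regularity. Hence the removal of one value from `V` costs the writer at least one pair.
All `m` values together give at most `n * b` pairs, and `n` pairs remain for a single value.
-/

theorem card_fiber_none_add_card_le {α β : Type*} [Finite α] [Finite β] (f : α → Option β)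
    (hf : ∀ y, ∃ x, f x = some y) :
    Nat.card {x // f x = none} + Nat.card β ≤ Nat.card α := by
  choose g hg using hf
  have hinj : Function.Injective (Sum.elim Subtype.val g : {x // f x = none} ⊕ β → α) := by
    refine Subtype.val_injective.sumElim (fun y y' h => ?_) ?_
    · exact Option.some.inj ((hg y).symm.trans (h ▸ hg y'))
    · rintro ⟨x, hx⟩ y rfl
      cases hx.symm.trans (hg y)
  simpa only [Nat.card_sum] using Nat.card_le_card_of_injective _ hinj

namespace SharedRegister

section Histories

variable {r m : ℕ} {v₀ v : Fin m} {h k : List (Event r m)} {e : Event r m}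

theorem pendingWrite_snoc :
    PendingWrite (h ++ [e]) v ↔
      e = Event.inv none v ∨ PendingWrite h v ∧ e ≠ Event.res none () := by
  constructor
  · rintro ⟨h₁, h₂, heq, hres⟩
    rcases h₂.eq_nil_or_concat' with rfl | ⟨h₂, e', rfl⟩
    · rw [List.append_nil] at heq
      exact Or.inl (List.singleton_inj.1 (List.append_inj_right' heq rfl))
    · rw [← List.append_assoc] at heq
      obtain ⟨rfl, he⟩ := List.append_inj' heq rfl
      obtain rfl := List.singleton_inj.1 he
      simp only [List.mem_append, List.mem_singleton, not_or] at hres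
      exact Or.inr ⟨⟨h₁, h₂, rfl, hres.1⟩, Ne.symm hres.2⟩
  · rintro (rfl | ⟨⟨h₁, h₂, rfl, hres⟩, he⟩)
    · exact ⟨h, [], by simp, by simp⟩
    · exact ⟨h₁, h₂ ++ [e], by simp, by simp [hres, he.symm]⟩

theorem PendingWrite.of_append (hv : PendingWrite (h ++ k) v) :
    PendingWrite h v ∨ Event.inv none v ∈ k := by
  induction k using List.reverseRecOn with
  | nil => exact Or.inl (by simpa using hv)
  | append_singleton k e ih =>
    rw [← List.append_assoc, pendingWrite_snoc] at hv
    rcases hv with rfl | ⟨hv, -⟩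
    · simp
    · exact (ih hv).imp_right fun hmem => List.mem_append_left _ hmem

theorem LastCompletedWrite.pendingWrite
    (hv : LastCompletedWrite v₀ (h ++ [Event.res none ()]) v) : PendingWrite h v := by
  rcases hv with ⟨hres, -⟩ | ⟨h₁, h₂, h₃, heq, hres₂, hres₃⟩
  · simp at hres
  · rcases h₃.eq_nil_or_concat' with rfl | ⟨h₃, e, rfl⟩
    · rw [List.append_nil] at heq
      exact ⟨h₁, h₂, List.append_inj_left' heq rfl, hres₂⟩
    · rw [← List.append_assoc] at heq
      have he := List.singleton_inj.1 (List.append_inj_right' heq rfl)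
      simp [← he] at hres₃

/-- After the events `h`, a read that overlaps no write invoked later may return `v`. -/
def Readable (v₀ : Fin m) (h : List (Event r m)) (v : Fin m) : Prop :=
  LastCompletedWrite v₀ h v ∨ PendingWrite h v

/-- The process that takes part in an event. -/
def Event.proc : Event r m → Proc r
  | .inv p _ => p
  | .access p => p
  | .res p _ => p

/-- The events of the writer, restricted to writes of values from `V`. The response of a write
invoked earlier is included, whatever its value. -/
inductive WriterEvent (V : Finset (Fin m)) : Event r m → Prop
  | inv {v : Fin m} (hv : v ∈ V) : WriterEvent V (Event.inv none v)
  | access : WriterEvent V (Event.access none)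
  | res : WriterEvent V (Event.res none ())

theorem WriterEvent.mono {V W : Finset (Fin m)} (hVW : V ⊆ W) (he : WriterEvent V e) :
    WriterEvent W e := by
  cases he with
  | inv hv => exact .inv (hVW hv)
  | access => exact .access
  | res => exact .res

theorem WriterEvent.proc_eq {V : Finset (Fin m)} (he : WriterEvent V e) : e.proc = none := by
  cases he <;> rfl

end Histories

namespace Algorithm

variable {r n m b : ℕ} {A : Algorithm.{u} r n m b}

section Runs

variable {p : Proc r} {C C' D : A.Config} {e : Event r m} {P Q : Event r m → Prop}

/-- A finite sequence of steps whose events all satisfy `P` leads from `C` to `D`. -/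
def Reaches (A : Algorithm.{u} r n m b) (P : Event r m → Prop) : A.Config → A.Config → Prop :=
  Relation.ReflTransGen fun C D => ∃ e, P e ∧ A.Step C e D

theorem Reaches.mono (hPQ : ∀ e, P e → Q e) (h : A.Reaches P C D) : A.Reaches Q C D :=
  Relation.ReflTransGen.mono (fun _ _ ⟨e, he, hs⟩ => ⟨e, hPQ e he, hs⟩) _ _ h

theorem reaches_access_of_reflTransGen
    (h : Relation.ReflTransGen (fun D D' : A.Config => A.Step D (Event.access p) D') C D) :
    A.Reaches (· = Event.access p) C D :=
  Relation.ReflTransGen.mono (fun _ _ hs => ⟨_, rfl, hs⟩) _ _ h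

theorem Step.reaches (h : A.Step C e D) (he : P e) : A.Reaches P C D :=
  Relation.ReflTransGen.single ⟨e, he, h⟩

theorem Execution.exists_append {h : List (Event r m)} (hC : A.Execution h C)
    (hCD : A.Reaches P C D) : ∃ es, (∀ e ∈ es, P e) ∧ A.Execution (h ++ es) D := by
  induction hCD with
  | refl => exact ⟨[], by simp, by simpa using hC⟩
  | tail _ hstep ih =>
    obtain ⟨es, hes, hD⟩ := ih
    obtain ⟨e, he, hs⟩ := hstep
    refine ⟨es ++ [e], ?_, by simpa using hD.snoc hs⟩
    simpa [or_imp, forall_and, he] using hes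

/-- `C` and `D` agree on the local part of process `p`. -/
structure LocalEq (p : Proc r) (C D : A.Config) : Prop where
  state : C.state p = D.state p
  active : C.active p = D.active p

/-- Process `p` cannot distinguish `C` from `D`: they agree on everything that its next step
depends on. -/
structure Indist (p : Proc r) (C D : A.Config) : Prop extends LocalEq p C D where
  mem : C.mem = D.mem

theorem LocalEq.symm (h : LocalEq p C D) : LocalEq p D C :=
  ⟨h.state.symm, h.active.symm⟩

theorem LocalEq.trans {E : A.Config} (h₁ : LocalEq p C D) (h₂ : LocalEq p D E) : LocalEq p C E :=
  ⟨h₁.state.trans h₂.state, h₁.active.trans h₂.active⟩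

theorem Indist.symm (h : Indist p C D) : Indist p D C :=
  ⟨h.toLocalEq.symm, h.mem.symm⟩

theorem Step.localEq (h : A.Step C e D) (hp : e.proc ≠ p) : LocalEq p C D := by
  cases h <;> constructor <;> first | rfl | exact (Function.update_of_ne hp.symm ..).symm

theorem Reaches.localEq (h : A.Reaches P C D) (hP : ∀ e, P e → e.proc ≠ p) : LocalEq p C D := by
  induction h with
  | refl => exact ⟨rfl, rfl⟩
  | tail _ hstep ih =>
    obtain ⟨e, he, hs⟩ := hstep
    exact ih.trans (hs.localEq (hP e he))

theorem Step.mem_eq (h : A.Step C e D) {i : Fin n} (hi : A.owner i ≠ e.proc) :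
    D.mem i = C.mem i := by
  cases h with
  | write p i' x s _ hact =>
    refine Function.update_of_ne ?_ ..
    rintro rfl
    exact hi (A.single_writer _ _ _ _ _ hact)
  | _ => rfl

theorem Reaches.mem_eq (h : A.Reaches P C D) {i : Fin n} (hP : ∀ e, P e → A.owner i ≠ e.proc) :
    D.mem i = C.mem i := by
  induction h with
  | refl => rfl
  | tail _ hstep ih =>
    obtain ⟨e, he, hs⟩ := hstep
    exact (hs.mem_eq (hP e he)).trans ih

theorem Step.exists_of_indist (h : A.Step C e C') (hCD : Indist e.proc C D) :
    ∃ D', A.Step D e D' ∧ Indist e.proc C' D' := by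
  obtain ⟨⟨hs, ha⟩, hm⟩ := hCD
  cases h with
  | inv p o idle =>
    exact ⟨_, .inv D p o (ha ▸ idle), ⟨by simp_all [Event.proc], by simp [Event.proc]⟩, hm⟩
  | read p i k busy hact =>
    exact ⟨_, .read D p i k (ha ▸ busy) (hs ▸ hact), ⟨by simp [Event.proc, hm], ha⟩, hm⟩
  | write p i x s busy hact =>
    exact ⟨_, .write D p i x s (ha ▸ busy) (hs ▸ hact), ⟨by simp [Event.proc], ha⟩, by simp [hm]⟩
  | res p y s busy hact =>
    exact ⟨_, .res D p y s (ha ▸ busy) (hs ▸ hact),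
      ⟨by simp [Event.proc], by simp [Event.proc]⟩, hm⟩

theorem Reaches.exists_of_indist (h : A.Reaches P C C') (hP : ∀ e, P e → e.proc = p)
    (hCD : Indist p C D) : ∃ D', A.Reaches P D D' ∧ Indist p C' D' := by
  induction h with
  | refl => exact ⟨D, .refl, hCD⟩
  | tail _ hstep ih =>
    obtain ⟨D₁, hD₁, hind₁⟩ := ih
    obtain ⟨e, he, hs⟩ := hstep
    obtain rfl := hP e he
    obtain ⟨D₂, hs₂, hind₂⟩ := hs.exists_of_indist hind₁
    exact ⟨D₂, hD₁.tail ⟨e, he, hs₂⟩, hind₂⟩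

theorem Step.not_active_of_res {y : Res m p} (h : A.Step C (Event.res p y) D) :
    D.active p = false := by
  cases h
  simp

theorem Step.exists_res_of_localEq {y : Res m p} (h : A.Step C (Event.res p y) C')
    (hCD : LocalEq p C D) : ∃ D', A.Step D (Event.res p y) D' := by
  cases h with
  | res _ _ s busy hact => exact ⟨_, .res D p y s (hCD.active ▸ busy) (hCD.state ▸ hact)⟩

end Runs

section SoloOperations

variable {p : Proc r} {o : Op m p} {y : Res m p} {C D : A.Config} {h : List (Event r m)}

/-- The configuration after process `p` has invoked operation `o`. -/
def Config.invoke (C : A.Config) (p : Proc r) (o : Op m p) : A.Config where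
  mem := C.mem
  state := Function.update C.state p (A.start p o (C.state p))
  active := Function.update C.active p true

theorem Step.invoke (o : Op m p) (hidle : C.active p = false) :
    A.Step C (Event.inv p o) (C.invoke p o) :=
  .inv C p o hidle

theorem LocalEq.invoke (hCD : LocalEq p C D) (o : Op m p) :
    LocalEq p (C.invoke p o) (D.invoke p o) :=
  ⟨by simp [Config.invoke, hCD.state], by simp [Config.invoke]⟩

/-- From `C`, the idle process `p` invokes `o`, runs in isolation, and gets the response `y`. -/
def SoloOp (C : A.Config) (p : Proc r) (o : Op m p) (y : Res m p) (D : A.Config) : Prop :=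
  C.active p = false ∧
    ∃ C', A.Reaches (· = Event.access p) (C.invoke p o) C' ∧ A.Step C' (Event.res p y) D

theorem ObstructionFree.exists_soloOp (hof : A.ObstructionFree) (hC : A.Execution h C)
    (hidle : C.active p = false) (o : Op m p) : ∃ y D, SoloOp C p o y D := by
  obtain ⟨C₁, D, y, hrun, hres⟩ :=
    hof _ _ (hC.snoc (.invoke o hidle)) p (by simp [Config.invoke])
  exact ⟨y, D, hidle, C₁, reaches_access_of_reflTransGen hrun, hres⟩

theorem SoloOp.exists_of_indist {C' : A.Config} (hop : SoloOp C p o y D) (hCC' : Indist p C C') :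
    ∃ D', SoloOp C' p o y D' := by
  obtain ⟨hidle, E, hrun, hres⟩ := hop
  obtain ⟨E', hrun', hEE'⟩ := hrun.exists_of_indist (by rintro _ rfl; rfl)
    ⟨hCC'.toLocalEq.invoke o, hCC'.mem⟩
  obtain ⟨D', hres'⟩ := hres.exists_res_of_localEq hEE'.toLocalEq
  exact ⟨D', hCC'.active ▸ hidle, E', hrun', hres'⟩

end SoloOperations

section Writes

variable {C D : A.Config} {h : List (Event r m)} {v₀ u : Fin m} {V : Finset (Fin m)}

theorem Execution.active_of_pendingWrite (hC : A.Execution h C) {v : Fin m}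
    (hv : PendingWrite h v) : C.active none = true := by
  induction hC with
  | nil =>
    obtain ⟨h₁, h₂, heq, -⟩ := hv
    simp at heq
  | @snoc h C C' e _ hs ih =>
    rcases pendingWrite_snoc.1 hv with rfl | ⟨hv, he⟩
    · cases hs
      simp
    · have hact := ih hv
      cases hs with
      | inv p _ _ => by_cases hp : none = p <;> simp [hp, hact]
      | read | write => exact hact
      | res p y _ _ _ =>
        rcases p with - | j
        · exact absurd rfl he
        · simpa using hact

/-- Some execution ends in `C` after which `u` is the only value that a read may return as long as
no further write is invoked. -/
def Stores (v₀ u : Fin m) (C : A.Config) : Prop :=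
  ∃ h, A.Execution h C ∧ ∀ v, Readable v₀ h v → v = u

theorem SoloOp.stores (hop : SoloOp C none u () D) (hC : A.Execution h C) : Stores v₀ u D := by
  obtain ⟨hidle, C', hrun, hres⟩ := hop
  obtain ⟨es, hes, hC'⟩ := (hC.snoc (.invoke (p := none) u hidle)).exists_append hrun
  have hD := hC'.snoc hres
  refine ⟨_, hD, fun v hv => ?_⟩
  rcases hv with hlast | hpend
  · have hpend := hlast.pendingWrite
    rw [List.append_assoc] at hpend
    rcases hpend.of_append with hpend | hmem
    · simp [hC.active_of_pendingWrite hpend] at hidle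
    · rcases List.mem_append.1 hmem with hmem | hmem
      · simpa using hmem
      · cases hes _ hmem
  · simpa [hres.not_active_of_res] using hD.active_of_pendingWrite hpend

theorem SoloOp.reaches_writerEvent (hop : SoloOp C none u () D) (hu : u ∈ V) :
    A.Reaches (WriterEvent V) C D := by
  obtain ⟨hidle, C', hrun, hres⟩ := hop
  exact (((Step.invoke (p := none) u hidle).reaches (.inv hu)).trans
    (hrun.mono (by rintro _ rfl; exact .access))).trans (hres.reaches .res)

theorem ObstructionFree.exists_writer_idle (hof : A.ObstructionFree) (hC : A.Execution h C)
    (V : Finset (Fin m)) : ∃ D, A.Reaches (WriterEvent V) C D ∧ D.active none = false := by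
  cases hact : C.active none with
  | false => exact ⟨C, .refl, hact⟩
  | true =>
    obtain ⟨C', D, y, hrun, hres⟩ := hof _ _ hC none hact
    have hrun' : A.Reaches (WriterEvent V) C C' :=
      (reaches_access_of_reflTransGen hrun).mono (by rintro _ rfl; exact .access)
    exact ⟨D, hrun'.trans (hres.reaches .res), hres.not_active_of_res⟩

theorem ObstructionFree.exists_stores (hof : A.ObstructionFree) (hC : A.Execution h C)
    (v₀ : Fin m) (hu : u ∈ V) : ∃ D, A.Reaches (WriterEvent V) C D ∧ Stores v₀ u D := by
  obtain ⟨D, hCD, hidle⟩ := hof.exists_writer_idle hC V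
  obtain ⟨es, -, hD⟩ := hC.exists_append hCD
  obtain ⟨⟨⟩, E, hop⟩ := hof.exists_soloOp hD hidle u
  exact ⟨E, hCD.trans (hop.reaches_writerEvent hu), hop.stores hD⟩

theorem Stores.eq_or_of_read
    (hreg : ∀ (h : List (Event r m)) (C : A.Config), A.Execution h C → Regular v₀ h)
    (hC : Stores v₀ u C) {j : Fin r} (hidle : C.active (some j) = false)
    {P : Event r m → Prop} (hP : ∀ w, ¬ P (Event.res (some j) w))
    (hrun : A.Reaches P (C.invoke (some j) ()) D) {y : Fin m} {E : A.Config}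
    (hres : A.Step D (Event.res (some j) y) E) : y = u ∨ P (Event.inv none y) := by
  obtain ⟨h, hC, hread⟩ := hC
  obtain ⟨es, hes, hD⟩ := (hC.snoc (.invoke (p := some j) () hidle)).exists_append hrun
  rcases hreg _ _ (hD.snoc hres) j y h es [] (by simp) fun w hw => hP w (hes _ hw) with
    hlast | hpend | hmem
  · exact Or.inl (hread y (Or.inl hlast))
  · exact Or.inl (hread y (Or.inr hpend))
  · exact Or.inr (hes _ hmem)

theorem Stores.eq_of_soloOp
    (hreg : ∀ (h : List (Event r m)) (C : A.Config), A.Execution h C → Regular v₀ h)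
    (hC : Stores v₀ u C) {j : Fin r} {y : Fin m} (hop : SoloOp C (some j) () y D) : y = u := by
  obtain ⟨hidle, C', hrun, hres⟩ := hop
  rcases hC.eq_or_of_read hreg hidle nofun hrun hres with hy | hy
  · exact hy
  · cases hy

end Writes

theorem le_pow_card_writer_registers (hreg : A.ImplementsRegular) (hof : A.ObstructionFree)
    (j : Fin r) : m ≤ b ^ Nat.card {i // A.owner i = none} := by
  obtain ⟨v₀, hreg⟩ := hreg
  choose D hrun hstores using
    fun u => hof.exists_stores Execution.nil v₀ (Finset.mem_univ u)
  have hlocal (u : Fin m) : LocalEq (some j) A.init (D u) :=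
    (hrun u).localEq fun e he => by simp [he.proc_eq]
  have hinj : Function.Injective fun (u : Fin m) (i : {i // A.owner i = none}) => (D u).mem i := by
    intro u u' huu'
    have hmem : (D u).mem = (D u').mem := by
      funext i
      by_cases hi : A.owner i = none
      · exact congrFun huu' ⟨i, hi⟩
      · have hmem_init (u : Fin m) : (D u).mem i = A.init.mem i :=
          (hrun u).mem_eq fun e he => by rwa [he.proc_eq]
        rw [hmem_init, hmem_init]
    obtain ⟨h, hD, -⟩ := hstores u
    obtain ⟨y, E, hop⟩ := hof.exists_soloOp hD (p := some j) (hlocal u).active.symm ()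
    obtain ⟨E', hop'⟩ := hop.exists_of_indist ⟨(hlocal u).symm.trans (hlocal u'), hmem⟩
    exact ((hstores u).eq_of_soloOp hreg hop).symm.trans ((hstores u').eq_of_soloOp hreg hop')
  simpa [Nat.card_fun] using Nat.card_le_card_of_injective _ hinj

section SilentReader

variable {C D : A.Config} {V W : Finset (Fin m)} {j : Fin r}

/-- The pairs `(i, x)` such that the writer, writing only values from `V`, can bring physical
register `i` to contain `x`. -/
def attainable (C : A.Config) (V : Finset (Fin m)) : Set (Fin n × Fin b) :=
  {ix | ∃ D, A.Reaches (WriterEvent V) C D ∧ D.mem ix.1 = ix.2}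

theorem mem_attainable_self (C : A.Config) (V : Finset (Fin m)) (i : Fin n) :
    (i, C.mem i) ∈ attainable C V :=
  ⟨C, .refl, rfl⟩

theorem le_ncard_attainable (C : A.Config) (V : Finset (Fin m)) :
    n ≤ (attainable C V).ncard := by
  have hinj : Function.Injective fun i => (i, C.mem i) := fun i i' hi => congrArg Prod.fst hi
  calc
    n = (Set.range fun i => (i, C.mem i)).ncard := by
      rw [Set.ncard_range_of_injective hinj, Nat.card_fin]
    _ ≤ (attainable C V).ncard :=
      Set.ncard_le_ncard (Set.range_subset_iff.2 (mem_attainable_self C V))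

theorem attainable_mono (hVW : V ⊆ W) : attainable C V ⊆ attainable C W :=
  fun _ ⟨D, hCD, hD⟩ => ⟨D, hCD.mono fun _ => .mono hVW, hD⟩

theorem Reaches.attainable_subset (hCD : A.Reaches (WriterEvent V) C D) :
    attainable D V ⊆ attainable C V :=
  fun _ ⟨E, hDE, hE⟩ => ⟨E, hCD.trans hDE, hE⟩

theorem Indist.attainable_subset (hCD : Indist none C D) : attainable C V ⊆ attainable D V := by
  rintro ix ⟨C', hCC', hix⟩
  obtain ⟨D', hDD', hC'D'⟩ := hCC'.exists_of_indist (fun _ he => he.proc_eq) hCD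
  exact ⟨D', hDD', hC'D'.mem ▸ hix⟩

/-- Whatever the writer does from `C` on, as long as it writes only values from `W`, it can still
bring each single register back to its content in `μ`. -/
def CanRestore (W : Finset (Fin m)) (μ : Fin n → Fin b) (C : A.Config) : Prop :=
  ∀ D, A.Reaches (WriterEvent W) C D → ∀ i, (i, μ i) ∈ attainable D W

theorem CanRestore.of_reaches {μ : Fin n → Fin b} (hC : CanRestore W μ C)
    (hCD : A.Reaches (WriterEvent W) C D) : CanRestore W μ D :=
  fun E hDE => hC E (hCD.trans hDE)

theorem CanRestore.of_indist {μ : Fin n → Fin b} (hC : CanRestore W μ C)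
    (hCD : Indist none C D) : CanRestore W μ D := by
  intro D' hDD' i
  obtain ⟨C', hCC', hD'C'⟩ := hDD'.exists_of_indist (fun _ he => he.proc_eq) hCD.symm
  exact hD'C'.symm.attainable_subset (hC C' hCC' i)

theorem CanRestore.exists_replay_step (hj : ∀ i, A.owner i ≠ some j) {D₁ E : A.Config}
    (hstep : A.Step D (Event.access (some j)) D₁) (hDE : LocalEq (some j) D E)
    (hE : CanRestore W D.mem E) :
    ∃ E₁, A.Reaches (fun e => e = Event.access (some j) ∨ WriterEvent W e) E E₁ ∧
      LocalEq (some j) D₁ E₁ ∧ CanRestore W D₁.mem E₁ := by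
  cases hstep with
  | write _ i x s _ hact => exact absurd (A.single_writer _ _ _ _ _ hact) (hj i)
  | read _ i k busy hact =>
    obtain ⟨F, hEF, hmem⟩ := hE E .refl i
    have hDF : LocalEq (some j) D F := hDE.trans (hEF.localEq fun e he => by simp [he.proc_eq])
    have hread := Step.read F (some j) i k (hDF.active ▸ busy) (hDF.state ▸ hact)
    have hind : Indist none F _ := ⟨hread.localEq (Option.some_ne_none j), rfl⟩
    exact ⟨_, (hEF.mono fun _ => Or.inr).trans (hread.reaches (Or.inl rfl)),
      ⟨by simp [hmem], hDF.active⟩, (hE.of_reaches hEF).of_indist hind⟩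

theorem CanRestore.exists_replay (hj : ∀ i, A.owner i ≠ some j) {D' E : A.Config}
    (hsolo : A.Reaches (· = Event.access (some j)) D D') (hDE : LocalEq (some j) D E)
    (hE : CanRestore W D.mem E) :
    ∃ E', A.Reaches (fun e => e = Event.access (some j) ∨ WriterEvent W e) E E' ∧
      LocalEq (some j) D' E' := by
  induction hsolo using Relation.ReflTransGen.head_induction_on generalizing E with
  | refl => exact ⟨E, .refl, hDE⟩
  | head hstep _ ih =>
    obtain ⟨_, rfl, hs⟩ := hstep
    obtain ⟨E₁, hEE₁, hlocal, hE₁⟩ := hE.exists_replay_step hj hs hDE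
    obtain ⟨E', hE₁E', hE'⟩ := ih hlocal hE₁
    exact ⟨E', hEE₁.trans hE₁E', hE'⟩

theorem CanRestore.mem_of_soloOp (hreg : A.ImplementsRegular) (hof : A.ObstructionFree)
    (hj : ∀ i, A.owner i ≠ some j) {h : List (Event r m)} (hC : A.Execution h C)
    (hrestore : CanRestore W C.mem C) (hW : W.Nonempty) {y : Fin m}
    (hop : SoloOp C (some j) () y D) : y ∈ W := by
  obtain ⟨v₀, hreg⟩ := hreg
  obtain ⟨hidle, C', hrun, hres⟩ := hop
  obtain ⟨u, hu⟩ := hW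
  obtain ⟨E, hCE, hE⟩ := hof.exists_stores hC v₀ hu
  have hlocal : LocalEq (some j) C E := hCE.localEq fun e he => by simp [he.proc_eq]
  have hind : Indist none E (E.invoke (some j) ()) :=
    ⟨(Step.invoke (p := some j) () (hlocal.active ▸ hidle)).localEq (Option.some_ne_none j), rfl⟩
  obtain ⟨E', hrun', hC'E'⟩ :=
    ((hrestore.of_reaches hCE).of_indist hind).exists_replay hj hrun (hlocal.invoke ())
  obtain ⟨F, hres'⟩ := hres.exists_res_of_localEq hC'E'
  rcases hE.eq_or_of_read hreg (hlocal.active ▸ hidle) (by rintro w (hw | hw) <;> cases hw)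
    hrun' hres' with rfl | hy | hy
  · exact hu
  · cases hy
  · cases hy with
    | inv hy => exact hy

theorem exists_attainable_ssubset (hreg : A.ImplementsRegular) (hof : A.ObstructionFree)
    (hj : ∀ i, A.owner i ≠ some j) (hV : V.Nontrivial) {h : List (Event r m)}
    (hC : A.Execution h C) (hidle : C.active (some j) = false) :
    ∃ v ∈ V, ∃ D, A.Reaches (WriterEvent (V.erase v)) C D ∧
      attainable D (V.erase v) ⊂ attainable C V := by
  obtain ⟨y, E, hop⟩ := hof.exists_soloOp hC hidle ()
  obtain ⟨v, hv, hy⟩ : ∃ v ∈ V, y ∉ V.erase v := by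
    by_cases hyV : y ∈ V
    · exact ⟨y, hyV, V.notMem_erase y⟩
    · obtain ⟨v, hv⟩ := hV.nonempty
      exact ⟨v, hv, fun hy => hyV (Finset.mem_of_mem_erase hy)⟩
  have hrestore : ¬ CanRestore (V.erase v) C.mem C := fun hrestore =>
    hy (hrestore.mem_of_soloOp hreg hof hj hC ((Finset.erase_nonempty hv).2 hV) hop)
  simp only [CanRestore, not_forall] at hrestore
  obtain ⟨D, hCD, i, hi⟩ := hrestore
  exact ⟨v, hv, D, hCD, hCD.attainable_subset.trans (attainable_mono (V.erase_subset v)),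
    fun hsub => hi (hsub (mem_attainable_self C V i))⟩

theorem add_card_le_ncard_attainable (hreg : A.ImplementsRegular) (hof : A.ObstructionFree)
    (hj : ∀ i, A.owner i ≠ some j) (V : Finset (Fin m)) {h : List (Event r m)}
    (hC : A.Execution h C) (hidle : C.active (some j) = false) :
    n + V.card ≤ (attainable C V).ncard + 1 := by
  induction V using Finset.strongInduction generalizing h C with
  | H V ih =>
    rcases le_or_gt V.card 1 with hV | hV
    · exact add_le_add (le_ncard_attainable C V) hV
    · obtain ⟨v, hv, D, hCD, hlt⟩ :=
        exists_attainable_ssubset hreg hof hj (Finset.one_lt_card_iff_nontrivial.1 hV) hC hidle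
      obtain ⟨es, -, hD⟩ := hC.exists_append hCD
      have hlocal : LocalEq (some j) C D := hCD.localEq fun e he => by simp [he.proc_eq]
      have hcard := ih (V.erase v) (Finset.erase_ssubset hv) hD (hlocal.active ▸ hidle)
      have hncard := Set.ncard_lt_ncard hlt
      have herase := Finset.card_erase_add_one hv
      lia

theorem add_le_mul_add_one_of_silent_reader (hreg : A.ImplementsRegular)
    (hof : A.ObstructionFree) (hj : ∀ i, A.owner i ≠ some j) : n + m ≤ n * b + 1 :=
  calc
    n + m = n + (Finset.univ : Finset (Fin m)).card := by simp
    _ ≤ (attainable A.init Finset.univ).ncard + 1 :=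
      add_card_le_ncard_attainable hreg hof hj Finset.univ .nil rfl
    _ ≤ n * b + 1 := by
      simpa [Set.ncard_univ] using Set.ncard_le_ncard (Set.subset_univ (attainable A.init _))

end SilentReader

end Algorithm

end SharedRegister

theorem theorem2 (r n m b : ℕ) (hr : 1 ≤ r) (hb : 2 ≤ b)
    (A : SharedRegister.Algorithm.{u} r n m b)
    (hreg : A.ImplementsRegular) (hof : A.ObstructionFree) :
    ⌈min (((m : ℝ) - 1) / ((b : ℝ) - 1)) ((r : ℝ) + Real.log (m : ℝ) / Real.log (b : ℝ))⌉
      ≤ (n : ℤ) := by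
  rw [Int.ceil_le, Int.cast_natCast]
  have hb' : (1 : ℝ) < b := by exact_mod_cast hb
  by_cases hown : ∀ j : Fin r, ∃ i, A.owner i = some j
  · have hm : (0 : ℝ) < m := by exact_mod_cast hreg.choose.pos
    have hcard : Nat.card {i // A.owner i = none} + r ≤ n := by
      simpa only [Nat.card_fin] using card_fiber_none_add_card_le A.owner hown
    have hcard' : (Nat.card {i // A.owner i = none} : ℝ) + r ≤ n := by exact_mod_cast hcard
    have hlog : Real.log m / Real.log b ≤ Nat.card {i // A.owner i = none} := by
      rw [Real.log_div_log, Real.logb_le_iff_le_rpow hb' hm, Real.rpow_natCast]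
      exact_mod_cast
        SharedRegister.Algorithm.le_pow_card_writer_registers hreg hof ⟨0, hr⟩
    exact (min_le_right _ _).trans (by linarith)
  · push Not at hown
    obtain ⟨j, hj⟩ := hown
    have hcount : (n : ℝ) + m ≤ n * b + 1 := by
      exact_mod_cast
        SharedRegister.Algorithm.add_le_mul_add_one_of_silent_reader hreg hof hj
    refine (min_le_left _ _).trans ?_
    rw [div_le_iff₀ (by linarith)]
    linarith
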